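/- **Setting.** A finite MDP $\mathcal M=(S,\mathrm{Act},\Sigma,\mathsf P,s_0,L)$ has finite sets $S$ of states and $\mathrm{Act}$ of actions, transition probabilities $\mathsf P(s,a,s')$ such that $\sum_{s'}\mathsf P(s,a,s')\in\{0,1\}$ for all $s,a$, an initial state $s_0$ and a labelling $L:S\times\mathrm{Act}\to\Sigma$. An action $a$ is available in $s$ if this sum is $1$; in each state some action is available. A strategy $\mu$ maps every finite path $s_0a_0\cdots s_n$ to a distribution over the actions available in $s_n$; with $s_0$ it induces a probability measure on infinite paths $\xi=s_0a_0s_1a_1\cdots$. The trace of $\xi$ is $L(\xi)=L(s_0,a_0)L(s_1,a_1)\cdots$. A nondeterministic Büchi automaton $\mathcal A=(Q,q_0,\delta,\alpha)$ over $\Sigma$ has a finite state set $Q$, nonempty successor sets $\delta(q,\sigma)\subseteq Q$, each equipped with a fixed order, and a set $\alpha$ of accepting transitions $(q,\sigma,q')$ with $q'\in\delta(q,\sigma)$. A run is accepting if some transition in $\alpha$ occurs infinitely often in it; $\mathcal L(\mathcal A)$ is the set of infinite words that have an accepting run. Let $k$ be the maximal size of the sets $\delta(q,\sigma)$ and $[k]=\{1,\dots,k\}$.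 The product $\mathcal M\times\mathcal A$ is the MDP with states $S\times Q$, actions $\mathrm{Act}\times[k]$, initial state $\langle s_0,q_0\rangle$, labels $L(s,a)$, and transition probabilities $\mathsf P^\times(\langle s,q\rangle,\langle a,i\rangle,\langle s',q'\rangle)=\mathsf P(s,a,s')$ if $q'$ is the $i$-th element of $\delta(q,L(s,a))$, and $0$ otherwise. Its accepting transitions are those $(\langle s,q\rangle,\langle a,i\rangle,\langle s',q'\rangle)$ of positive probability with $(q,L(s,a),q')\in\alpha$; a path is accepting if some accepting transition occurs infinitely often in it. Put $$\mathsf{Psem}(\mathcal M,\mathcal A)=\sup_\mu\mathbb P_{\mathcal M^\mu}\{\xi: L(\xi)\in\mathcal L(\mathcal A)\},\qquad \mathsf{Psyn}(\mathcal M,\mathcal A)=\sup_\mu\mathbb P_{(\mathcal M\times\mathcal A)^\mu}\{\xi:\xi\text{ is accepting}\},$$ where $\mu$ ranges over the strategies of $\mathcal M$ and of $\mathcal M\times\mathcal A$, respectively. The automaton $\mathcal A$ is *good for MDPs* (GFM) if $\mathsf{Psem}(\mathcal N,\mathcal A)=\mathsf{Psyn}(\mathcal N,\mathcal A)$ for all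 finite MDPs $\mathcal N$ with label set $\Sigma$. **Theorem.** Let $\mathcal A_{\mathrm{GFM}}=(Q,q_0,\delta,\alpha)$ be a GFM Büchi automaton over $\Sigma$ with maximal out-degree $k$, and let $\mathcal M=(S,\mathrm{Act},\Sigma,\mathsf P,s_0,L)$ be a finite MDP. Let $\mathcal M'$ be the MDP with the same states and initial state, action set $\mathrm{Act}\times[k]$, label set $\Sigma\times[k]$, $\mathsf P'(s,\langle a,i\rangle,s')=\mathsf P(s,a,s')$ and $L'(s,\langle a,i\rangle)=\langle L(s,a),i\rangle$. Let $\mathcal A_{\mathrm{DBA}}$ be the deterministic Büchi automaton over $\Sigma\times[k]$ with initial state $q_0$ and state set $Q$ together with a rejecting sink, in which the letter $\langle\sigma,i\rangle$ leads from $q\in Q$ to the $i$-th element $q'$ of $\delta(q,\sigma)$, this transition being accepting iff $(q,\sigma,q')\in\alpha$, and to the sink if $\delta(q,\sigma)$ has fewer than $i$ elements. Then $$\mathsf{Psem}(\mathcal M,\mathcal A_{\mathrm{GFM}})=\mathsf{Psyn}(\mathcal M,\mathcal A_{\mathrm{GFM}})=\mathsf{Psyn}(\mathcal M',\mathcal A_{\mathrm{DBA}})=\mathsf{Psem}(\mathcal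 M',\mathcal A_{\mathrm{DBA}}).$$ -/

import Mathlib

open MeasureTheory ProbabilityTheory Finset
open scoped NNReal ENNReal

universe u v

/-! ## Markov decision processes -/

/-- A Markov decision process with finite state space `S`, action set `Act` and label set `L`:
transition probabilities `P s a s'`, an initial state and a labelling of state-action pairs.
For all `s`, `a` the numbers `P s a s'` sum to `1` (then `a` is available in `s`) or to `0`
(then it is not), and in every state some action is available. -/
structure MDP (S Act L : Type*) [Fintype S] where
  P : S → Act → S → ℝ≥0
  sum_P : ∀ s a, ∑ s', P s a s' = 0 ∨ ∑ s', P s a s' = 1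
  exists_available : ∀ s, ∃ a, ∑ s', P s a s' = 1
  init : S
  label : S → Act → L

/-- One step of a path `s₀ a₀ s₁ a₁ …`: a state with the action chosen there. -/
structure Step (S Act : Type*) where
  state : S
  action : Act

namespace Step

variable {S Act : Type*}

instance : MeasurableSpace (Step S Act) := ⊤

instance : DiscreteMeasurableSpace (Step S Act) := ⟨fun _ => trivial⟩

instance [Countable S] [Countable Act] : Countable (Step S Act) :=
  Function.Injective.countable (f := fun x : Step S Act => (x.state, x.action))
    (fun x y h => by cases x; cases y; simp_all)

end Step

namespace MDP

variable {S Act L : Type*} [Fintype S]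

/-- `a ∈ Act(s)`: the action `a` is available in the state `s`. -/
def Available (M : MDP S Act L) (s : S) (a : Act) : Prop := ∑ s', M.P s a s' = 1

open Classical in
/-- The distribution `P(s, a, ·)` of the next state.  (For an action that is not available the
value is irrelevant: strategies never choose it.) -/
noncomputable def next (M : MDP S Act L) (s : S) (a : Act) : PMF S :=
  if h : M.Available s a then
    PMF.ofFintype (fun s' => (M.P s a s' : ℝ≥0∞)) (by
      have h' : ∑ s', M.P s a s' = 1 := h
      exact_mod_cast congrArg ((↑) : ℝ≥0 → ℝ≥0∞) h')
  else PMF.pure s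

/-- A (history-dependent, randomised) strategy: to a finite path `s₀ a₀ … sₙ₋₁ aₙ₋₁ sₙ`, given as
the sequence `h` of its first `n` steps and its last state `s = sₙ`, it assigns a distribution over
the actions available in `s`.  It is convenient to let `h` range over all sequences of steps; the
values at sequences that are not paths of `M` play no role, since these have probability `0`. -/
structure Strategy (M : MDP S Act L) where
  choice : (n : ℕ) → (Fin n → Step S Act) → S → PMF Act
  available : ∀ n h s, ∀ a ∈ (choice n h s).support, M.Available s a

/-- The law of the first step `(s₀, a₀)`, where `a₀` is chosen by the strategy. -/
noncomputable def firstStep (M : MDP S Act L) (μ : M.Strategy) : PMF (Step S Act) :=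
  (μ.choice 0 Fin.elim0 M.init).map (Step.mk M.init)

/-- The conditional law of the step `(sₙ₊₁, aₙ₊₁)` given the steps `0, …, n`: the state `sₙ₊₁` is
drawn from `P(sₙ, aₙ, ·)` and then the action `aₙ₊₁` is chosen by the strategy. -/
noncomputable def nextStep (M : MDP S Act L) (μ : M.Strategy) (n : ℕ)
    (x : (i : Iic n) → Step S Act) : PMF (Step S Act) :=
  (M.next (x ⟨n, by simp⟩).state (x ⟨n, by simp⟩).action).bind fun s =>
    (μ.choice (n + 1) (fun i => x ⟨i, by simpa using Nat.lt_succ_iff.mp i.2⟩) s).map (Step.mk s)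

/-- `nextStep` as a Markov kernel. -/
noncomputable def stepKernel [Finite Act] (M : MDP S Act L) (μ : M.Strategy) (n : ℕ) :
    Kernel ((i : Iic n) → Step S Act) (Step S Act) where
  toFun x := (M.nextStep μ n x).toMeasure
  measurable' := measurable_of_countable _

instance [Finite Act] (M : MDP S Act L) (μ : M.Strategy) (n : ℕ) :
    IsMarkovKernel (M.stepKernel μ n) :=
  ⟨fun x => PMF.toMeasure.isProbabilityMeasure (M.nextStep μ n x)⟩

/-- The probability measure on infinite paths of `M` (from the initial state) under the strategy
`μ`, given by the Ionescu-Tulcea theorem. -/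
noncomputable def pathMeasure [Finite Act] (M : MDP S Act L) (μ : M.Strategy) :
    Measure (ℕ → Step S Act) :=
  ((M.firstStep μ).toMeasure.map (fun x (_ : Iic 0) => x)).bind
    (Kernel.traj (X := fun _ => Step S Act) (M.stepKernel μ) 0)

/-- The trace `L(s₀, a₀) L(s₁, a₁) …` of an infinite path. -/
def trace (M : MDP S Act L) (ξ : ℕ → Step S Act) : ℕ → L :=
  fun n => M.label (ξ n).state (ξ n).action

end MDP

/-! ## Büchi automata -/

/-- A complete nondeterministic Büchi automaton over the alphabet `L` with transition-based
acceptance.  `succ q σ` is the set `δ(q, σ)` of successors with its predefined order, i.e. a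
duplicate-free list. -/
structure NBA (Q L : Type*) where
  init : Q
  succ : Q → L → List Q
  nodup : ∀ q σ, (succ q σ).Nodup
  complete : ∀ q σ, succ q σ ≠ []
  acc : Set (Q × L × Q)
  acc_subset : ∀ q σ q', (q, σ, q') ∈ acc → q' ∈ succ q σ

namespace NBA

variable {Q L : Type*}

/-- `r` is the sequence of states of a run of `A` on the word `w`. -/
def IsRun (A : NBA Q L) (w : ℕ → L) (r : ℕ → Q) : Prop :=
  r 0 = A.init ∧ ∀ n, r (n + 1) ∈ A.succ (r n) (w n)

/-- The Büchi condition `inf(ρ) ∩ α ≠ ∅`. -/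
def AcceptingRun (A : NBA Q L) (w : ℕ → L) (r : ℕ → Q) : Prop :=
  ∃ t ∈ A.acc, ∃ᶠ n in Filter.atTop, (r n, w n, r (n + 1)) = t

/-- The language of `A`. -/
def language (A : NBA Q L) : Set (ℕ → L) :=
  {w | ∃ r, A.IsRun w r ∧ A.AcceptingRun w r}

/-- `A` is deterministic. -/
def IsDeterministic (A : NBA Q L) : Prop := ∀ q σ, (A.succ q σ).length ≤ 1

/-- The maximal out-degree `k` of `A` over all states and letters. -/
noncomputable def deg (A : NBA Q L) : ℕ := ⨆ p : Q × L, (A.succ p.1 p.2).length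

theorem length_le_deg [Fintype Q] (A : NBA Q L) (q : Q) (σ : L) :
    (A.succ q σ).length ≤ A.deg :=
  le_ciSup (f := fun p : Q × L => (A.succ p.1 p.2).length)
    ⟨Fintype.card Q, by rintro _ ⟨p, rfl⟩; exact (A.nodup p.1 p.2).length_le_card⟩ (q, σ)

theorem deg_pos [Fintype Q] (A : NBA Q L) (σ : L) : 0 < A.deg :=
  (List.length_pos_iff.mpr (A.complete A.init σ)).trans_le (A.length_le_deg A.init σ)

/-- The deterministic automaton over `L × [k]` in which the letter `(σ, i)` leads from `q` to the
`i`-th `σ`-successor of `q` (indices start at `0`), made complete by a rejecting sink `none` that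
is entered when there is no such successor. -/
def dba (A : NBA Q L) : NBA (Option Q) (L × Fin A.deg) where
  init := some A.init
  succ p τ := match p with
    | some q => [(A.succ q τ.1)[(τ.2 : ℕ)]?]
    | none => [none]
  nodup p τ := by cases p <;> simp
  complete p τ := by cases p <;> simp
  acc := {t | ∃ q σ i q', t = (some q, (σ, i), some q') ∧ (q, σ, q') ∈ A.acc ∧
    (A.succ q σ)[(i : ℕ)]? = some q'}
  acc_subset := by
    rintro _ _ _ ⟨q, σ, i, q', h, -, hi⟩
    simp only [Prod.mk.injEq] at h
    obtain ⟨rfl, rfl, rfl⟩ := h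
    simp [hi]

theorem dba_isDeterministic (A : NBA Q L) : A.dba.IsDeterministic := by
  intro p τ
  cases p <;> simp [dba]

end NBA

/-! ## Products, and the semantic and syntactic probabilities -/

namespace MDP

variable {S Act Q L : Type*} [Fintype S] [Fintype Q]

open Classical in
theorem sum_ite_succ (M : MDP S Act L) (l : Option Q) (s : S) (a : Act) :
    ∑ x : S × Q, (if l = some x.2 then M.P s a x.1 else 0) =
      if l.isSome then ∑ s', M.P s a s' else 0 := by
  rw [Fintype.sum_prod_type]
  cases l <;> simp

open Classical in
/-- The product `M × A`, with state space `S × Q` and action set `Act × [k]`, where `k` is the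
maximal out-degree of `A` and the index chooses the successor in `A` (indices start at `0`). -/
noncomputable def product (M : MDP S Act L) (A : NBA Q L) :
    MDP (S × Q) (Act × Fin A.deg) L where
  P x b y := if (A.succ x.2 (M.label x.1 b.1))[(b.2 : ℕ)]? = some y.2 then M.P x.1 b.1 y.1 else 0
  sum_P x b := by
    rw [sum_ite_succ]
    split_ifs
    · exact M.sum_P _ _
    · exact Or.inl rfl
  exists_available x := by
    obtain ⟨a, ha⟩ := M.exists_available x.1
    refine ⟨(a, ⟨0, A.deg_pos (M.label x.1 a)⟩), ?_⟩
    rw [sum_ite_succ, if_pos, ha]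
    simpa using List.length_pos_iff.mpr (A.complete x.2 (M.label x.1 a))
  init := (M.init, A.init)
  label x b := M.label x.1 b.1

/-- The set of accepting transitions of the product `M × A`. -/
def productAcc (M : MDP S Act L) (A : NBA Q L) :
    Set ((S × Q) × (Act × Fin A.deg) × (S × Q)) :=
  {t | 0 < (M.product A).P t.1 t.2.1 t.2.2 ∧
    (t.1.2, M.label t.1.1 t.2.1.1, t.2.2.2) ∈ A.acc}

/-- An infinite path of the product is accepting if some accepting transition occurs in it
infinitely often. -/
def AcceptingPath (M : MDP S Act L) (A : NBA Q L) (ξ : ℕ → Step (S × Q) (Act × Fin A.deg)) :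
    Prop :=
  ∃ t ∈ M.productAcc A,
    ∃ᶠ n in Filter.atTop, ((ξ n).state, (ξ n).action, (ξ (n + 1)).state) = t

/-- The maximal semantic satisfaction probability. -/
noncomputable def psem [Finite Act] (M : MDP S Act L) (A : NBA Q L) : ℝ≥0∞ :=
  ⨆ μ : M.Strategy, M.pathMeasure μ {ξ | M.trace ξ ∈ A.language}

/-- The maximal syntactic satisfaction probability. -/
noncomputable def psyn [Finite Act] (M : MDP S Act L) (A : NBA Q L) : ℝ≥0∞ :=
  ⨆ μ : (M.product A).Strategy, (M.product A).pathMeasure μ {ξ | M.AcceptingPath A ξ}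

/-- The MDP `M'` with action set `Act × [k]` and label set `L × [k]`, where `k` is the maximal
out-degree of `A`. -/
def expand (M : MDP S Act L) (A : NBA Q L) : MDP S (Act × Fin A.deg) (L × Fin A.deg) where
  P s b s' := M.P s b.1 s'
  sum_P s b := M.sum_P s b.1
  exists_available s := by
    obtain ⟨a, ha⟩ := M.exists_available s
    exact ⟨(a, ⟨0, A.deg_pos (M.label s a)⟩), ha⟩
  init := M.init
  label s b := (M.label s b.1, b.2)

end MDP

/-- `A` is good for MDPs (GFM): the semantic and the syntactic probability agree for all finite MDPs. -/
def NBA.IsGFM {Q L : Type*} [Fintype Q] (A : NBA Q L) : Prop :=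
  ∀ (S : Type u) (Act : Type v) [Fintype S] [Finite Act] (M : MDP S Act L), M.psem A = M.psyn A

/-!
The semantic and syntactic probabilities of `M` agree because `A` is good for MDPs. The other
equalities hold for every automaton: with `N = M.expand A` and `B = A.dba` they follow from the
cycle of inequalities `M.psyn A ≤ N.psem B ≤ N.psyn B ≤ M.psyn A`, each of which turns a strategy
of one process into a strategy of another one that does at least as well.

* `psyn_le_psem_expand`: a path of the product `M × A` becomes a path of `N` when the automaton
  states are forgotten. Nothing is lost, since the run of `B` on the trace recovers these states.
* `psem_le_psyn_of_isDeterministic`: for a deterministic automaton a path determines the only run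
  on its trace, and so a path of the product.
* `psyn_expand_le_psyn`: the product `N × B` differs from `M × A` only in that it may enter the
  rejecting sink. Replacing the choices that lead there by valid ones loses no accepting path.

All three are instances of `pathMeasure_le_of_simulation`, which compares two path measures along a
translation of paths. The weight of a prefix is the product of the transition probabilities and of
the probabilities of the chosen actions, so a translation that is injective on prefixes and does not
decrease these factors maps the first measure, restricted to the paths of interest, to a measure
that is below the second one on all prefix sets. Then it is below it on all sets
(`measure_le_of_forall_atom_le`). An inequality is enough, and it is all that holds in the third
case, where a repaired choice adds weight to the choice it is replaced by. It also makes it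
unnecessary to know that the language of the automaton is measurable.
-/

/-! ### Measures on sequences over a finite type -/

/-- A cylinder at level `n` is a finite disjoint union of the atoms compared in the hypothesis, and
cylinders approximate every measurable set in the measure `ν₁ + ν₂`. -/
theorem measure_le_of_forall_atom_le {T : Type*} [Finite T] [MeasurableSpace T]
    [DiscreteMeasurableSpace T] {ν₁ ν₂ : Measure (ℕ → T)} [IsFiniteMeasure ν₁] [IsFiniteMeasure ν₂]
    (h : ∀ (n : ℕ) (y : Iic n → T), ν₁ (Preorder.frestrictLe (π := fun _ => T) n ⁻¹' {y}) ≤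
      ν₂ (Preorder.frestrictLe (π := fun _ => T) n ⁻¹' {y})) :
    ν₁ ≤ ν₂ := by
  have hcyl : ∀ t ∈ measurableCylinders (fun _ : ℕ => T), ν₁ t ≤ ν₂ t := by
    intro t ht
    rw [measurableCylinders_nat] at ht
    simp only [Set.mem_iUnion, Set.mem_singleton_iff] at ht
    obtain ⟨n, B, -, rfl⟩ := ht
    change ν₁ (Preorder.frestrictLe (π := fun _ => T) n ⁻¹' B) ≤
      ν₂ (Preorder.frestrictLe (π := fun _ => T) n ⁻¹' B)
    have hB : B.Countable := B.to_countable
    have hm : ∀ y : Iic n → T, MeasurableSet (Preorder.frestrictLe (π := fun _ => T) n ⁻¹' {y}) :=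
      fun y => Preorder.measurable_frestrictLe n (measurableSet_singleton y)
    rw [← Set.biUnion_preimage_singleton,
      measure_biUnion hB (fun y _ z _ hyz => Set.disjoint_singleton.2 hyz |>.preimage _)
        (fun y _ => hm y),
      measure_biUnion hB (fun y _ z _ hyz => Set.disjoint_singleton.2 hyz |>.preimage _)
        (fun y _ => hm y)]
    exact ENNReal.tsum_le_tsum fun y => h n y
  have hdense := Measure.MeasureDense.of_generateFrom_isSetAlgebra_finite (ν₁ + ν₂)
    (𝒜 := measurableCylinders (fun _ : ℕ => T))
    ⟨empty_mem_measurableCylinders _, fun _ => compl_mem_measurableCylinders,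
      fun _ _ => union_mem_measurableCylinders⟩ generateFrom_measurableCylinders.symm
  refine Measure.le_iff.2 fun s hs => ?_
  refine ENNReal.le_of_forall_pos_le_add fun ε hε _ => ?_
  obtain ⟨t, ht, hst⟩ := hdense.approx s hs (measure_ne_top _ _) ε (by exact_mod_cast hε)
  rw [ENNReal.ofReal_coe_nnreal] at hst
  have hsplit : ν₁ (s \ t) + ν₂ (t \ s) ≤ ε := by
    refine le_trans ?_ hst.le
    rw [Measure.add_apply]
    exact add_le_add (measure_mono (by simp [symmDiff_def]))
      (measure_mono (by simp [symmDiff_def]))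
  calc ν₁ s ≤ ν₁ t + ν₁ (s \ t) := by
        refine (measure_mono (t := t ∪ s \ t) (by simp)).trans (measure_union_le _ _)
    _ ≤ ν₂ t + ν₁ (s \ t) := by exact add_le_add_left (hcyl t ht) _
    _ ≤ (ν₂ s + ν₂ (t \ s)) + ν₁ (s \ t) := by
        gcongr
        refine (measure_mono (t := s ∪ t \ s) (by simp)).trans (measure_union_le _ _)
    _ = ν₂ s + (ν₁ (s \ t) + ν₂ (t \ s)) := by ring
    _ ≤ ν₂ s + ε := by gcongr

/-! ### Steps and point masses -/

instance {S Act : Type*} [Finite S] [Finite Act] : Finite (Step S Act) :=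
  Finite.of_injective (fun x : Step S Act => (x.state, x.action))
    (fun x y h => by cases x; cases y; simp_all)

theorem PMF.apply_le_map_apply {α β : Type*} (p : PMF α) (g : α → β) (a : α) :
    p a ≤ p.map g (g a) := by
  classical
  rw [PMF.map_apply]
  refine le_trans ?_ (ENNReal.le_tsum a)
  simp

theorem Step.map_mk_apply {S Act : Type*} (p : PMF Act) (s : S) (x : Step S Act)
    [Decidable (x.state = s)] : p.map (Step.mk s) x =
      if x.state = s then p x.action else 0 := by
  classical
  obtain ⟨s', a⟩ := x
  rw [PMF.map_apply]
  split_ifs with h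
  · simp only at h
    subst h
    simp [Step.mk.injEq]
  · simp only at h
    simp [Step.mk.injEq, h]

/-! ### Paths of a Markov decision process and the weights of their prefixes -/

namespace MDP

variable {S Act L : Type*} [Fintype S]

theorem next_apply (M : MDP S Act L) {s : S} {a : Act} (h : M.Available s a) (s' : S) :
    M.next s a s' = M.P s a s' := by
  simp [next, h]

theorem available_of_P_pos (M : MDP S Act L) {s : S} {a : Act} {s' : S} (h : 0 < M.P s a s') :
    M.Available s a := by
  refine (M.sum_P s a).resolve_left fun h0 => h.ne' ?_
  exact (Finset.sum_eq_zero_iff.1 h0) s' (Finset.mem_univ _)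

theorem firstStep_apply (M : MDP S Act L) (μ : M.Strategy) (ξ : ℕ → Step S Act)
    [Decidable ((ξ 0).state = M.init)] :
    M.firstStep μ (ξ 0) = if (ξ 0).state = M.init then
      μ.choice 0 (fun i => ξ i) (ξ 0).state (ξ 0).action else 0 := by
  rw [firstStep, Step.map_mk_apply]
  split_ifs with h
  · rw [h]
    congr!
  · rfl

theorem nextStep_apply (M : MDP S Act L) (μ : M.Strategy) (ξ : ℕ → Step S Act) (n : ℕ) :
    M.nextStep μ n (Preorder.frestrictLe (π := fun _ => Step S Act) n ξ) (ξ (n + 1)) =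
      M.next (ξ n).state (ξ n).action (ξ (n + 1)).state *
        μ.choice (n + 1) (fun i => ξ i) (ξ (n + 1)).state (ξ (n + 1)).action := by
  classical
  rw [nextStep, PMF.bind_apply]
  simp only [Step.map_mk_apply]
  rw [tsum_eq_single (ξ (n + 1)).state]
  · simp [Preorder.frestrictLe]
  · intro s hs
    simp [hs.symm]

variable [Finite Act]

theorem pathMeasure_eq_trajMeasure (M : MDP S Act L) (μ : M.Strategy) :
    M.pathMeasure μ = Kernel.trajMeasure (X := fun _ => Step S Act) (M.firstStep μ).toMeasure
      (M.stepKernel μ) := rfl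

instance (M : MDP S Act L) (μ : M.Strategy) : IsProbabilityMeasure (M.pathMeasure μ) := by
  rw [pathMeasure_eq_trajMeasure]
  infer_instance

/-- The set of infinite sequences of steps that agree with `ξ` in the steps `0, …, n`. -/
abbrev prefixSet (ξ : ℕ → Step S Act) (n : ℕ) : Set (ℕ → Step S Act) :=
  Preorder.frestrictLe (π := fun _ => Step S Act) n ⁻¹'
    {Preorder.frestrictLe (π := fun _ => Step S Act) n ξ}

theorem pathMeasure_prefixSet_zero (M : MDP S Act L) (μ : M.Strategy) (ξ : ℕ → Step S Act) :
    M.pathMeasure μ (prefixSet ξ 0) = M.firstStep μ (ξ 0) := by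
  have hmap : (M.pathMeasure μ).map (Preorder.frestrictLe (π := fun _ => Step S Act) 0) =
      (M.firstStep μ).toMeasure.map (fun x (_ : Iic 0) => x) := by
    rw [pathMeasure, Measure.map_comp _ _ (by fun_prop), Kernel.traj_map_frestrictLe,
      Kernel.partialTraj_self, Measure.id_comp]
  rw [prefixSet, ← Measure.map_apply (by fun_prop) (measurableSet_singleton _), hmap,
    Measure.map_apply (by fun_prop) (measurableSet_singleton _),
    ← PMF.toMeasure_apply_singleton _ _ (measurableSet_singleton _)]
  congr 1
  ext x
  simp only [Set.mem_preimage, Set.mem_singleton_iff, funext_iff]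
  refine ⟨fun h => h ⟨0, by simp⟩, ?_⟩
  rintro rfl ⟨i, hi⟩
  obtain rfl : i = 0 := by simpa using hi
  rfl

theorem pathMeasure_prefixSet_succ (M : MDP S Act L) (μ : M.Strategy) (ξ : ℕ → Step S Act)
    (n : ℕ) :
    M.pathMeasure μ (prefixSet ξ (n + 1)) = M.pathMeasure μ (prefixSet ξ n) *
      M.nextStep μ n (Preorder.frestrictLe (π := fun _ => Step S Act) n ξ) (ξ (n + 1)) := by
  have h := congrArg (fun ν => ν ({Preorder.frestrictLe (π := fun _ => Step S Act) n ξ} ×ˢ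
    {ξ (n + 1)})) (Kernel.map_frestrictLe_trajMeasure_compProd_eq_map_trajMeasure
      (X := fun _ => Step S Act) (μ₀ := (M.firstStep μ).toMeasure) (κ := M.stepKernel μ) (a := n))
  beta_reduce at h
  rw [← pathMeasure_eq_trajMeasure, Measure.compProd_apply_prod (measurableSet_singleton _)
    (measurableSet_singleton _), Measure.restrict_singleton, lintegral_smul_measure,
    lintegral_dirac, Measure.map_apply (by fun_prop) (measurableSet_singleton _),
    Measure.map_apply (by fun_prop) ((measurableSet_singleton _).prod (measurableSet_singleton _))]
    at h
  have hstep : M.stepKernel μ n (Preorder.frestrictLe (π := fun _ => Step S Act) n ξ)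
      {ξ (n + 1)} = M.nextStep μ n (Preorder.frestrictLe (π := fun _ => Step S Act) n ξ)
        (ξ (n + 1)) :=
    PMF.toMeasure_apply_singleton _ _ (measurableSet_singleton _)
  rw [hstep, smul_eq_mul] at h
  rw [h]
  congr 1
  ext η
  simp only [Set.mem_preimage, Set.mem_singleton_iff, Set.mem_prod, funext_iff,
    Preorder.frestrictLe_apply, Subtype.forall, Finset.mem_Iic]
  refine ⟨fun H => ⟨fun i hi => H i (hi.trans n.le_succ), H _ le_rfl⟩, fun H i hi => ?_⟩
  rcases Nat.le_succ_iff.1 hi with hi | rfl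
  exacts [H.1 i hi, H.2]

theorem ae_pathMeasure_prefixSet_ne_zero (M : MDP S Act L) (μ : M.Strategy) :
    ∀ᵐ ξ ∂M.pathMeasure μ, ∀ n, M.pathMeasure μ (prefixSet ξ n) ≠ 0 := by
  refine ae_all_iff.2 fun n => ?_
  let B : Set (Iic n → Step S Act) :=
    {y | M.pathMeasure μ (Preorder.frestrictLe (π := fun _ => Step S Act) n ⁻¹' {y}) = 0}
  have hB : M.pathMeasure μ (Preorder.frestrictLe (π := fun _ => Step S Act) n ⁻¹' B) = 0 := by
    rw [← Set.biUnion_preimage_singleton, measure_biUnion_null_iff B.to_countable]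
    exact fun y hy => hy
  refine measure_mono_null (fun ξ hξ => ?_) hB
  simpa [B] using hξ

/-- `ξ` is an infinite path of `M`: it starts in the initial state and all its transitions have
positive probability. -/
structure IsPath (M : MDP S Act L) (ξ : ℕ → Step S Act) : Prop where
  state_zero : (ξ 0).state = M.init
  P_pos : ∀ n, 0 < M.P (ξ n).state (ξ n).action (ξ (n + 1)).state

/-- Almost surely all prefixes have positive weight. The weights contain the transition
probabilities as factors, once the positive weight has shown that the chosen actions are
available. -/
theorem ae_isPath (M : MDP S Act L) (μ : M.Strategy) :
    ∀ᵐ ξ ∂M.pathMeasure μ, M.IsPath ξ := by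
  classical
  filter_upwards [M.ae_pathMeasure_prefixSet_ne_zero μ] with ξ hξ
  have h0 := hξ 0
  rw [pathMeasure_prefixSet_zero, firstStep_apply, ne_eq, ite_eq_right_iff, Classical.not_imp]
    at h0
  have hs : ∀ n, M.next (ξ n).state (ξ n).action (ξ (n + 1)).state ≠ 0 ∧
      μ.choice (n + 1) (fun i => ξ i) (ξ (n + 1)).state (ξ (n + 1)).action ≠ 0 := fun n => by
    have h := hξ (n + 1)
    rw [pathMeasure_prefixSet_succ, nextStep_apply] at h
    exact mul_ne_zero_iff.1 (right_ne_zero_of_mul h)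
  have hav : ∀ n, M.Available (ξ n).state (ξ n).action := by
    rintro (_ | n)
    · exact μ.available _ _ _ _ ((PMF.mem_support_iff _ _).2 h0.2)
    · exact μ.available _ _ _ _ ((PMF.mem_support_iff _ _).2 (hs n).2)
  refine ⟨h0.1, fun n => ?_⟩
  have h := (hs n).1
  rw [M.next_apply (hav n)] at h
  exact pos_iff_ne_zero.2 (by exact_mod_cast h)

/-! ### Simulations -/

/-- If `f` translates the paths of `M₁` in `E₁` into `E₂`, in such a way that prefixes can be
recovered from their translations and that neither the transition probabilities nor the
probabilities of the chosen actions decrease, then `E₁` is at most as probable as `E₂`.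
The translated paths need not exhaust the probability in `M₂`: this is what allows the strategy
of `M₂` to deviate outside of the translations. -/
theorem pathMeasure_le_of_simulation {S₁ Act₁ L₁ S₂ Act₂ L₂ : Type*} [Fintype S₁] [Finite Act₁]
    [Fintype S₂] [Finite Act₂] (M₁ : MDP S₁ Act₁ L₁) (M₂ : MDP S₂ Act₂ L₂) (μ₁ : M₁.Strategy)
    (μ₂ : M₂.Strategy) {E₁ : Set (ℕ → Step S₁ Act₁)} {E₂ : Set (ℕ → Step S₂ Act₂)}
    (f : (ℕ → Step S₁ Act₁) → ℕ → Step S₂ Act₂) (hf : Measurable f)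
    (hE : ∀ ξ ∈ E₁, M₁.IsPath ξ → f ξ ∈ E₂)
    (hinit : ∀ ξ ∈ E₁, M₁.IsPath ξ → (f ξ 0).state = M₂.init)
    (hP : ∀ ξ ∈ E₁, M₁.IsPath ξ → ∀ n,
      M₁.P (ξ n).state (ξ n).action (ξ (n + 1)).state ≤
        M₂.P (f ξ n).state (f ξ n).action (f ξ (n + 1)).state)
    (hμ : ∀ ξ ∈ E₁, M₁.IsPath ξ → ∀ n,
      μ₁.choice n (fun i => ξ i) (ξ n).state (ξ n).action ≤
        μ₂.choice n (fun i => f ξ i) (f ξ n).state (f ξ n).action)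
    (hinj : ∀ ξ ∈ E₁, M₁.IsPath ξ → ∀ ξ' ∈ E₁, M₁.IsPath ξ' → ∀ n,
      (∀ i ≤ n, f ξ i = f ξ' i) → ∀ i ≤ n, ξ i = ξ' i) :
    M₁.pathMeasure μ₁ E₁ ≤ M₂.pathMeasure μ₂ E₂ := by
  classical
  have hprefix : ∀ ξ ∈ E₁, M₁.IsPath ξ → ∀ n,
      M₁.pathMeasure μ₁ (prefixSet ξ n) ≤ M₂.pathMeasure μ₂ (prefixSet (f ξ) n) := by
    intro ξ hξ hp n
    induction n with
    | zero =>
      rw [pathMeasure_prefixSet_zero, pathMeasure_prefixSet_zero, firstStep_apply,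
        firstStep_apply, if_pos hp.state_zero, if_pos (hinit ξ hξ hp)]
      exact hμ ξ hξ hp 0
    | succ n ih =>
      have h1 := M₁.available_of_P_pos (hp.P_pos n)
      have h2 := M₂.available_of_P_pos ((hp.P_pos n).trans_le (hP ξ hξ hp n))
      rw [pathMeasure_prefixSet_succ, pathMeasure_prefixSet_succ, nextStep_apply, nextStep_apply,
        M₁.next_apply h1, M₂.next_apply h2]
      gcongr
      · exact hP ξ hξ hp n
      · exact hμ ξ hξ hp (n + 1)
  -- by injectivity on prefixes, the preimage of an atom meets `G` in part of a single atom
  let G : Set (ℕ → Step S₁ Act₁) := {ξ | ξ ∈ E₁ ∧ M₁.IsPath ξ}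
  have hle : ((M₁.pathMeasure μ₁).restrict G).map f ≤ M₂.pathMeasure μ₂ := by
    refine measure_le_of_forall_atom_le fun n y => ?_
    have hy : MeasurableSet (Preorder.frestrictLe (π := fun _ => Step S₂ Act₂) n ⁻¹' {y}) :=
      Preorder.measurable_frestrictLe n (measurableSet_singleton y)
    rw [Measure.map_apply hf hy, Measure.restrict_apply (hf hy)]
    rcases Set.eq_empty_or_nonempty
      (f ⁻¹' (Preorder.frestrictLe (π := fun _ => Step S₂ Act₂) n ⁻¹' {y}) ∩ G) with h | h
    · simp [h]
    · obtain ⟨ξ, hξy, hξ, hp⟩ := h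
      obtain rfl : Preorder.frestrictLe (π := fun _ => Step S₂ Act₂) n (f ξ) = y := hξy
      refine le_trans (measure_mono ?_) (hprefix ξ hξ hp n)
      rintro η ⟨hηy, hη, hηp⟩
      have hfη : ∀ i ≤ n, f η i = f ξ i := fun i hi =>
        congrFun (show _ = _ from hηy) ⟨i, Finset.mem_Iic.2 hi⟩
      exact funext fun i => hinj η hη hηp ξ hξ hp n hfη i (Finset.mem_Iic.1 i.2)
  calc M₁.pathMeasure μ₁ E₁ ≤ M₁.pathMeasure μ₁ G := by
        refine measure_mono_ae ?_
        filter_upwards [M₁.ae_isPath μ₁] with ξ hp hξ using ⟨hξ, hp⟩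
    _ ≤ M₁.pathMeasure μ₁ (f ⁻¹' E₂ ∩ G) :=
        measure_mono fun ξ hξ => ⟨hE ξ hξ.1 hξ.2, hξ⟩
    _ ≤ (M₁.pathMeasure μ₁).restrict G (f ⁻¹' E₂) := Measure.le_restrict_apply _ _
    _ ≤ ((M₁.pathMeasure μ₁).restrict G).map f E₂ := Measure.le_map_apply hf.aemeasurable _
    _ ≤ M₂.pathMeasure μ₂ E₂ := hle _

end MDP

/-! ### Deterministic automata -/

namespace NBA

variable {Q L : Type*}

/-- The state of `A` after reading the finite word `w`, when the first successor is taken in each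
step. For deterministic `A` this is the only state reachable by `w`. -/
def detRun (A : NBA Q L) : (n : ℕ) → (Fin n → L) → Q
  | 0, _ => A.init
  | n + 1, w => (A.succ (detRun A n (Fin.init w)) (w (Fin.last n))).head (A.complete _ _)

theorem isRun_detRun (A : NBA Q L) (w : ℕ → L) :
    A.IsRun w fun n => A.detRun n fun i => w i :=
  ⟨rfl, fun _ => List.head_mem _⟩

theorem IsDeterministic.succ_eq {A : NBA Q L} (hA : A.IsDeterministic) {q q' : Q} {σ : L}
    (h : q' ∈ A.succ q σ) : A.succ q σ = [q'] := by
  obtain ⟨p, hp⟩ := List.length_eq_one_iff.1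
    ((hA q σ).antisymm (List.length_pos_iff.2 (A.complete q σ)))
  rw [hp, List.mem_singleton] at h
  rw [hp, h]

theorem IsDeterministic.isRun_unique {A : NBA Q L} (hA : A.IsDeterministic) {w : ℕ → L}
    {r r' : ℕ → Q} (hr : A.IsRun w r) (hr' : A.IsRun w r') (n : ℕ) : r n = r' n := by
  induction n with
  | zero => rw [hr.1, hr'.1]
  | succ n ih =>
    have h := hr'.2 n
    rw [← ih, hA.succ_eq (hr.2 n), List.mem_singleton] at h
    exact h.symm

end NBA

theorem Filter.Frequently.exists_frequently_eq_and {α β : Type*} [Finite β] {l : Filter α}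
    {p : α → Prop} (h : ∃ᶠ x in l, p x) (g : α → β) : ∃ b, ∃ᶠ x in l, g x = b ∧ p x := by
  by_contra! H
  refine h ?_
  filter_upwards [Filter.eventually_all.2 H] with x hx
  exact hx (g x) rfl

namespace MDP

variable {S Act Q L : Type*} [Fintype S] [Fintype Q]

theorem product_available_iff (M : MDP S Act L) (A : NBA Q L) {x : S × Q}
    {b : Act × Fin A.deg} : (M.product A).Available x b ↔
      (b.2 : ℕ) < (A.succ x.2 (M.label x.1 b.1)).length ∧ M.Available x.1 b.1 := by
  simp only [Available, product]
  rw [sum_ite_succ]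
  simp only [isSome_getElem?]
  split_ifs with h <;> simp [h]

theorem product_P_of_getElem? (M : MDP S Act L) (A : NBA Q L) {x y : S × Q}
    {b : Act × Fin A.deg} (h : (A.succ x.2 (M.label x.1 b.1))[(b.2 : ℕ)]? = some y.2) :
    (M.product A).P x b y = M.P x.1 b.1 y.1 := by
  simp [product, h]

theorem getElem?_of_product_P_pos (M : MDP S Act L) (A : NBA Q L) {x y : S × Q}
    {b : Act × Fin A.deg} (h : 0 < (M.product A).P x b y) :
    (A.succ x.2 (M.label x.1 b.1))[(b.2 : ℕ)]? = some y.2 := by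
  by_contra hn
  simp [product, hn] at h

/-! ### Semantic acceptance by a deterministic automaton -/

/-- For a deterministic automaton the product only records the run on the trace, so a strategy of
`M` can be followed in the product. -/
theorem psem_le_psyn_of_isDeterministic [Finite Act] (M : MDP S Act L) (A : NBA Q L)
    (hA : A.IsDeterministic) : M.psem A ≤ M.psyn A := by
  refine iSup_le fun μ => ?_
  let ν : (M.product A).Strategy :=
    { choice n h x := (μ.choice n (fun i => ⟨(h i).state.1, (h i).action.1⟩) x.1).map
        fun a => (a, ⟨0, A.deg_pos (M.label x.1 a)⟩)
      available n h x b hb := by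
        rw [PMF.support_map] at hb
        obtain ⟨a, ha, rfl⟩ := hb
        exact (M.product_available_iff A).2
          ⟨List.length_pos_iff.2 (A.complete _ _), μ.available _ _ _ _ ha⟩ }
  refine le_iSup_of_le (f := fun ν : (M.product A).Strategy =>
    (M.product A).pathMeasure ν {ξ | M.AcceptingPath A ξ}) ν ?_
  let f : (ℕ → Step S Act) → ℕ → Step (S × Q) (Act × Fin A.deg) := fun ξ n =>
    ⟨((ξ n).state, A.detRun n fun i => M.trace ξ i),
      ((ξ n).action, ⟨0, A.deg_pos (M.trace ξ n)⟩)⟩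
  have hf : Measurable f := by
    refine measurable_pi_iff.2 fun n => ?_
    let F : (Iic n → Step S Act) → Step (S × Q) (Act × Fin A.deg) := fun x =>
      ⟨((x ⟨n, by simp⟩).state, A.detRun n fun i =>
        M.label (x ⟨i, by simp [i.2.le]⟩).state (x ⟨i, by simp [i.2.le]⟩).action),
        ((x ⟨n, by simp⟩).action, ⟨0, A.deg_pos (M.trace (fun _ => x ⟨n, by simp⟩) n)⟩)⟩
    exact (measurable_of_countable F).comp (Preorder.measurable_frestrictLe (X := fun _ => Step S Act) n)
  have hsucc : ∀ ξ n, (A.succ (f ξ n).state.2 (M.trace ξ n))[((f ξ n).action.2 : ℕ)]? =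
      some (f ξ (n + 1)).state.2 := fun ξ n => by
    rw [hA.succ_eq ((A.isRun_detRun (M.trace ξ)).2 n)]
    rfl
  have hP : ∀ ξ n, (M.product A).P (f ξ n).state (f ξ n).action (f ξ (n + 1)).state =
      M.P (ξ n).state (ξ n).action (ξ (n + 1)).state := fun ξ n =>
    M.product_P_of_getElem? A (hsucc ξ n)
  refine pathMeasure_le_of_simulation M (M.product A) μ ν f hf ?_ ?_
    (fun ξ _ _ n => (hP ξ n).ge) ?_ ?_
  · rintro ξ ⟨r, hr, t, ht, hfreq⟩ hp
    obtain ⟨t', ht'⟩ := hfreq.exists_frequently_eq_and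
      fun n => ((f ξ n).state, (f ξ n).action, (f ξ (n + 1)).state)
    refine ⟨t', ?_, ht'.mono fun n h => h.1⟩
    obtain ⟨n, rfl, rfl⟩ := ht'.exists
    refine ⟨(hP ξ n).symm ▸ hp.P_pos n, ?_⟩
    have hrun := hA.isRun_unique (A.isRun_detRun (M.trace ξ)) hr
    rw [← hrun n, ← hrun (n + 1)] at ht
    exact ht
  · exact fun ξ _ hp => Prod.ext hp.state_zero rfl
  · exact fun ξ _ _ n => PMF.apply_le_map_apply _ _ _
  · intro ξ _ _ ξ' _ _ n h i hi
    have h' := h i hi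
    simp only [f, Step.mk.injEq, Prod.mk.injEq] at h'
    cases hx : ξ i
    cases hy : ξ' i
    simp_all

/-! ### Resolving the nondeterminism of the automaton by actions -/

/-- The product `M × A` is simulated by the expanded process: the successor index chosen in the
product is written on the trace, and the automaton states are recovered as the run of `A.dba`. -/
theorem psyn_le_psem_expand [Finite Act] (M : MDP S Act L) (A : NBA Q L) :
    M.psyn A ≤ (M.expand A).psem A.dba := by
  refine iSup_le fun μ => ?_
  -- the automaton state that the product has reached after the history `h`
  let q : (n : ℕ) → (Fin n → Step S (Act × Fin A.deg)) → Q := fun n h =>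
    (A.dba.detRun n fun i => (M.expand A).label (h i).state (h i).action).getD A.init
  let ν : (M.expand A).Strategy :=
    { choice n h s := μ.choice n
        (fun i => ⟨((h i).state, q i fun j => h ⟨j, j.2.trans i.2⟩), (h i).action⟩) (s, q n h)
      available n h s b hb :=
        ((M.product_available_iff A).1 (μ.available _ _ _ _ hb)).2 }
  refine le_iSup_of_le (f := fun ν : (M.expand A).Strategy =>
    (M.expand A).pathMeasure ν {ξ | (M.expand A).trace ξ ∈ A.dba.language}) ν ?_
  let f : (ℕ → Step (S × Q) (Act × Fin A.deg)) → ℕ → Step S (Act × Fin A.deg) := fun ξ n =>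
    ⟨(ξ n).state.1, (ξ n).action⟩
  have hf : Measurable f := measurable_pi_iff.2 fun n =>
    (measurable_of_countable fun x : Step (S × Q) (Act × Fin A.deg) =>
      (⟨x.state.1, x.action⟩ : Step S (Act × Fin A.deg))).comp (measurable_pi_apply n)
  have hrun : ∀ ξ, (M.product A).IsPath ξ →
      A.dba.IsRun ((M.expand A).trace (f ξ)) fun n => some (ξ n).state.2 := by
    refine fun ξ hp => ⟨congrArg (fun x => some x.2) hp.state_zero, fun n => ?_⟩
    exact List.mem_singleton.2 (M.getElem?_of_product_P_pos A (hp.P_pos n)).symm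
  have hq : ∀ ξ, (M.product A).IsPath ξ → ∀ n, q n (fun i => f ξ i) = (ξ n).state.2 := by
    intro ξ hp n
    have h := A.dba_isDeterministic.isRun_unique (A.dba.isRun_detRun _) (hrun ξ hp) n
    exact congrArg (fun o => o.getD A.init) h
  have hlift : ∀ ξ, (M.product A).IsPath ξ → ∀ n,
      ξ n = ⟨((f ξ n).state, q n fun i => f ξ i), (f ξ n).action⟩ := by
    intro ξ hp n
    rw [hq ξ hp]
  refine pathMeasure_le_of_simulation (M.product A) (M.expand A) μ ν f hf ?_ ?_ ?_ ?_ ?_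
  · rintro ξ ⟨t, ht, hfreq⟩ hp
    refine ⟨_, hrun ξ hp,
      (some t.1.2, (M.label t.1.1 t.2.1.1, t.2.1.2), some t.2.2.2), ?_, ?_⟩
    · exact ⟨_, _, _, _, rfl, ht.2, M.getElem?_of_product_P_pos A ht.1⟩
    · refine hfreq.mono fun n hn => ?_
      subst hn
      rfl
  · exact fun ξ _ hp => congrArg Prod.fst hp.state_zero
  · intro ξ _ hp n
    rw [M.product_P_of_getElem? A (M.getElem?_of_product_P_pos A (hp.P_pos n))]
    rfl
  · intro ξ _ hp n
    have h1 : (fun i : Fin n => ξ i) = fun i : Fin n =>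
        ⟨((f ξ i).state, q i fun j => f ξ j), (f ξ i).action⟩ :=
      funext fun i => hlift ξ hp i
    have h2 : (ξ n).state = ((f ξ n).state, q n fun i => f ξ i) :=
      congrArg Step.state (hlift ξ hp n)
    rw [h1, h2]
  · intro ξ _ hp ξ' _ hp' n h i hi
    have hpre : (fun j : Fin i => f ξ j) = fun j : Fin i => f ξ' j :=
      funext fun j => h j (j.2.le.trans hi)
    rw [hlift ξ hp i, hlift ξ' hp' i, hpre, h i hi]

/-- The product of the expanded process with `A.dba` is simulated by `M × A`: a choice of an index
that has no successor leads to the rejecting sink, so it may be replaced by any other index. -/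
theorem psyn_expand_le_psyn [Finite Act] (M : MDP S Act L) (A : NBA Q L) :
    (M.expand A).psyn A.dba ≤ M.psyn A := by
  refine iSup_le fun μ => ?_
  -- `g` is the inverse of the translation `f₀` below on the steps that avoid the sink
  let g : Step (S × Q) (Act × Fin A.deg) →
      Step (S × Option Q) ((Act × Fin A.deg) × Fin A.dba.deg) := fun x =>
    ⟨(x.state.1, some x.state.2),
      (x.action, ⟨0, A.dba.deg_pos ((M.expand A).label x.state.1 x.action)⟩)⟩
  let ν : (M.product A).Strategy :=
    { choice n h x := (μ.choice n (fun i => g (h i)) (x.1, some x.2)).map fun c =>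
        if (c.1.2 : ℕ) < (A.succ x.2 (M.label x.1 c.1.1)).length then c.1
        else (c.1.1, ⟨0, A.deg_pos (M.label x.1 c.1.1)⟩)
      available n h x b hb := by
        rw [PMF.support_map] at hb
        obtain ⟨c, hc, rfl⟩ := hb
        have hav : M.Available x.1 c.1.1 :=
          (((M.expand A).product_available_iff A.dba).1 (μ.available _ _ _ _ hc)).2
        rw [product_available_iff]
        beta_reduce
        split_ifs with hlt
        · exact ⟨hlt, hav⟩
        · exact ⟨List.length_pos_iff.2 (A.complete _ _), hav⟩ }
  refine le_iSup_of_le (f := fun ν : (M.product A).Strategy =>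
    (M.product A).pathMeasure ν {ξ | M.AcceptingPath A ξ}) ν ?_
  let f₀ : Step (S × Option Q) ((Act × Fin A.deg) × Fin A.dba.deg) →
      Step (S × Q) (Act × Fin A.deg) := fun x =>
    ⟨(x.state.1, x.state.2.getD A.init), x.action.1⟩
  have hf : Measurable fun (ξ : ℕ → Step (S × Option Q) ((Act × Fin A.deg) × Fin A.dba.deg)) n =>
      f₀ (ξ n) :=
    measurable_pi_iff.2 fun n => (measurable_of_countable f₀).comp (measurable_pi_apply n)
  -- the sink is absorbing and rejecting, so accepting paths never visit it
  have hsome : ∀ ξ, (M.expand A).AcceptingPath A.dba ξ → ((M.expand A).product A.dba).IsPath ξ →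
      ∀ n, (ξ n).state.2 = some (f₀ (ξ n)).state.2 := by
    rintro ξ ⟨t, ⟨-, _, _, _, _, heq, -⟩, hfreq⟩ hp n
    rcases hn : (ξ n).state.2 with _ | q
    · have hsink : ∀ m ≥ n, (ξ m).state.2 = none := by
        intro m hm
        induction m, hm using Nat.le_induction with
        | base => exact hn
        | succ m _ ih =>
          have h := (M.expand A).getElem?_of_product_P_pos A.dba (hp.P_pos m)
          have hmem := List.mem_of_getElem? h
          rw [ih] at hmem
          exact List.mem_singleton.1 hmem
      obtain ⟨m, hm, rfl⟩ := (Filter.frequently_atTop.1 hfreq) n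
      have := hsink m hm
      simp_all
    · simp [f₀, hn]
  have hsucc : ∀ ξ, (M.expand A).AcceptingPath A.dba ξ → ((M.expand A).product A.dba).IsPath ξ →
      ∀ n, (A.succ (f₀ (ξ n)).state.2
          (M.label (f₀ (ξ n)).state.1 (f₀ (ξ n)).action.1))[((f₀ (ξ n)).action.2 : ℕ)]? =
        some (f₀ (ξ (n + 1))).state.2 := by
    intro ξ ha hp n
    have hmem := List.mem_of_getElem? ((M.expand A).getElem?_of_product_P_pos A.dba (hp.P_pos n))
    rw [hsome ξ ha hp n, hsome ξ ha hp (n + 1)] at hmem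
    exact (List.mem_singleton.1 hmem).symm
  have hP : ∀ ξ, (M.expand A).AcceptingPath A.dba ξ → ((M.expand A).product A.dba).IsPath ξ →
      ∀ n, (M.product A).P (f₀ (ξ n)).state (f₀ (ξ n)).action (f₀ (ξ (n + 1))).state =
        ((M.expand A).product A.dba).P (ξ n).state (ξ n).action (ξ (n + 1)).state := by
    intro ξ ha hp n
    rw [M.product_P_of_getElem? A (hsucc ξ ha hp n), (M.expand A).product_P_of_getElem? A.dba
      ((M.expand A).getElem?_of_product_P_pos A.dba (hp.P_pos n))]
    rfl
  have hg : ∀ ξ, (M.expand A).AcceptingPath A.dba ξ → ((M.expand A).product A.dba).IsPath ξ →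
      ∀ n, g (f₀ (ξ n)) = ξ n := by
    intro ξ ha hp n
    -- the successor index chosen in `A.dba` can only be `0`
    have hlt := (List.getElem?_eq_some_iff.1
      ((M.expand A).getElem?_of_product_P_pos A.dba (hp.P_pos n))).1
    have h0 := Nat.lt_one_iff.1 (hlt.trans_le (A.dba_isDeterministic _ _))
    have h1 : (ξ n).state = ((ξ n).state.1, some (f₀ (ξ n)).state.2) :=
      Prod.ext rfl (hsome ξ ha hp n)
    have h2 : (ξ n).action = ((ξ n).action.1, ⟨0, h0 ▸ (ξ n).action.2.2⟩) :=
      Prod.ext rfl (Fin.ext h0)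
    change (⟨((ξ n).state.1, some (f₀ (ξ n)).state.2), _⟩ : Step _ _) = ⟨(ξ n).state, (ξ n).action⟩
    rw [h1, h2]
  refine pathMeasure_le_of_simulation ((M.expand A).product A.dba) (M.product A) μ ν
    (fun ξ n => f₀ (ξ n)) hf ?_ ?_ (fun ξ ha hp n => (hP ξ ha hp n).ge) ?_ ?_
  · rintro ξ ha hp
    obtain ⟨t, ⟨hpos, hacc⟩, hfreq⟩ := id ha
    refine ⟨((t.1.1, t.1.2.getD A.init), t.2.1.1, (t.2.2.1, t.2.2.2.getD A.init)), ?_,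
      hfreq.mono fun n hn => by subst hn; rfl⟩
    obtain ⟨n, rfl⟩ := hfreq.exists
    refine ⟨(hP ξ ha hp n).symm ▸ hpos, ?_⟩
    obtain ⟨q, σ, i, q', heq, hmem, -⟩ := hacc
    simp only [Prod.mk.injEq] at heq
    obtain ⟨h1, h2, h3⟩ := heq
    simp only [h1, h3, Option.getD_some]
    obtain rfl : _ = σ := congrArg Prod.fst h2
    exact hmem
  · intro ξ _ hp
    have h := hp.state_zero
    simp only [f₀, h]
    rfl
  · intro ξ ha hp n
    have h1 : (fun i : Fin n => ξ i) = fun i : Fin n => g (f₀ (ξ i)) :=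
      funext fun i => (hg ξ ha hp i).symm
    have h2 : (ξ n).state = ((f₀ (ξ n)).state.1, some (f₀ (ξ n)).state.2) :=
      Prod.ext rfl (hsome ξ ha hp n)
    have hlt := (List.getElem?_eq_some_iff.1 (hsucc ξ ha hp n)).1
    rw [h1, h2]
    refine (PMF.apply_le_map_apply _ (fun c : (Act × Fin A.deg) × Fin A.dba.deg =>
      if (c.1.2 : ℕ) < (A.succ (f₀ (ξ n)).state.2
        (M.label (f₀ (ξ n)).state.1 c.1.1)).length then c.1
      else (c.1.1, ⟨0, A.deg_pos (M.label (f₀ (ξ n)).state.1 c.1.1)⟩)) _).trans_eq ?_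
    rw [if_pos hlt]
  · intro ξ ha hp ξ' ha' hp' n h i hi
    rw [← hg ξ ha hp i, ← hg ξ' ha' hp' i]
    exact congrArg g (h i hi)

end MDP

theorem mainTheorem4 {S : Type u} {Act : Type v} {Q L : Type*} [Fintype S] [Finite Act] [Fintype Q]
    (M : MDP S Act L) (A : NBA Q L) (hA : NBA.IsGFM.{u, v} A) :
    M.psem A = M.psyn A ∧
      M.psyn A = (M.expand A).psyn A.dba ∧
      (M.expand A).psyn A.dba = (M.expand A).psem A.dba := by
  have h₁ := M.psyn_le_psem_expand A
  have h₂ := (M.expand A).psem_le_psyn_of_isDeterministic A.dba A.dba_isDeterministic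
  have h₃ := M.psyn_expand_le_psyn A
  exact ⟨hA S Act M, (h₁.trans h₂).antisymm h₃, (h₃.trans h₁).antisymm h₂⟩
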